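/- Let $X$ be a finite set, $\Sigma=X\cup X^{-1}$, and let $F=F(X)$ be the free group on $X$, whose elements are identified with reduced words over $\Sigma$; write $|g|$ for the length of $g\in F$ and $S_k=\{g\in F : |g|=k\}$. *Density.* A set $R\subseteq F$ is *regular* if the set of reduced words of its elements is a regular language over $\Sigma$. Put $f_k(R)=|R\cap S_k|/|S_k|$ (and $f_k(R)=0$ if $S_k=\emptyset$) and $g_R(t)=\sum_{k\ge 0} f_k(R)\,t^k$. If $g_R$ is a rational function which at $t=1$ has no singularity or a simple pole, then the *Cesàro density* of $R$ is $\mu_0(R)=-\operatorname{Res}_{t=1} g_R(t)$. A set $R$ is *thick* if it has a Cesàro density and $\mu_0(R)>0$. *Special automata.* Consider finite automata $\mathcal A=(S,\Sigma,\delta,i_0,z_0)$ with one initial state $i_0$ and one final state $z_0$, in which every state is the source of at most one arrow with any given label. A state is of *type* $x\in\Sigma$ if some arrow labelled $x$ enters it. Such an $\mathcal A$ is *special* over $F$ if no arrow enters $i_0$; every state is accessible from $i_0$; from every state there is a directed path to $z_0$; all arrows entering a given state have the same label; and no arrow exiting from a state of type $x$ has the label $x^{-1}$. *Thick monoids.*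 Let $\mathcal A$ be special over $F$ with at least one arrow exiting from $z_0$. The associated automaton of *second type*, $\mathcal A_2$, consists of all states accessible from $z_0$ and all arrows of $\mathcal A$ between them, with $z_0$ as both the initial and the final state. It is *$\Sigma$-complete* if from every state of type $x$ there exit arrows with all labels in $\Sigma\smallsetminus\{x^{-1}\}$. A *thick monoid* is a set $T\subseteq F$ of the form $T=L(\mathcal A_2)$ with $\mathcal A_2$ a $\Sigma$-complete automaton of second type. *Reduced product.* For $w\in F$ and $T\subseteq F$, the reduced product $w\circ T$ is defined if $|wt|=|w|+|t|$ for all $t\in T$, and then $w\circ T=\{wt : t\in T\}$. **Theorem.** Let $R$ be a regular subset of $F$. Then $R$ has a Cesàro density $\mu_0(R)$, and $R$ is thick if and only if there are $w\in F$ and a thick monoid $T$ such that the reduced product $w\circ T$ is defined and $w\circ T\subseteq R$. -/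

import Mathlib

open Filter Topology Polynomial

noncomputable section

/-! ### Regular subsets of a free group and their Cesaro density

The letters of the alphabet `Σ = X ∪ X⁻¹` are the pairs in `X × Bool`, as in Mathlib's `FreeGroup`;
an element of `FreeGroup X` is identified with its reduced word `g.toWord`. -/

/-- A subset `R` of the free group is regular if the language of the reduced words of its elements
is a regular language over `Σ = X ∪ X⁻¹`. -/
def IsRegularSubset {X : Type*} [DecidableEq X] (R : Set (FreeGroup X)) : Prop :=
  Language.IsRegular (FreeGroup.toWord '' R : Language (X × Bool))

/-- The sphere `S_k` of radius `k` in the free group. -/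
def freeSphere (X : Type*) [DecidableEq X] (k : ℕ) : Set (FreeGroup X) :=
  {g | g.norm = k}

/-- The frequency `f_k(R) = |R ∩ S_k| / |S_k|`. (The sphere is empty only when the rank is `0` and
`0 < k`; then the value is `0`.) -/
def frequency {X : Type*} [DecidableEq X] (R : Set (FreeGroup X)) (k : ℕ) : ℝ :=
  ((R ∩ freeSphere X k).ncard : ℝ) / ((freeSphere X k).ncard : ℝ)

/-- The frequency generating function `g_R(t) = ∑ f_k(R) t ^ k`, a formal power series. -/
def frequencyGenFun {X : Type*} [DecidableEq X] (R : Set (FreeGroup X)) : PowerSeries ℝ :=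
  PowerSeries.mk (frequency R)

/-- `R` has Cesaro density `μ`: the generating function `g_R` is a rational function `p / q` which
has at `t = 1` either no singularity or a simple pole, and its residue there is `-μ`
(that is, `(t - 1) * (p / q)(t)` tends to `-μ` as `t → 1`, `t ≠ 1`). -/
def HasCesaroDensity {X : Type*} [DecidableEq X] (R : Set (FreeGroup X)) (μ : ℝ) : Prop :=
  ∃ p q : ℝ[X], q ≠ 0 ∧
    (q : PowerSeries ℝ) * frequencyGenFun R = (p : PowerSeries ℝ) ∧
    Tendsto (fun t : ℝ => (t - 1) * (p.eval t / q.eval t)) (𝓝[≠] 1) (𝓝 (-μ))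

/-- `R` is thick if its Cesaro density is strictly positive. -/
def IsThick {X : Type*} [DecidableEq X] (R : Set (FreeGroup X)) : Prop :=
  ∃ μ : ℝ, HasCesaroDensity R μ ∧ 0 < μ

/-! ### Special automata and thick monoids -/

/-- A deterministic automaton with one initial and one final state. Each state is the source of at
most one arrow with a given label: `step s a = some t` means that there is an arrow labelled `a`
from `s` to `t`, and `step s a = none` that no arrow labelled `a` exits from `s`. -/
structure Automaton (A S : Type*) where
  step : S → A → Option S
  start : S
  final : S

namespace Automaton

/-- The state reached from a given state along the path labelled by a word, if that path exists. -/
def run {A S : Type*} (M : Automaton A S) : S → List A → Option S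
  | s, [] => some s
  | s, a :: w => (M.step s a).bind fun t => M.run t w

/-- There is a directed path from `s` to `t`. -/
def Reaches {A S : Type*} (M : Automaton A S) (s t : S) : Prop :=
  ∃ w : List A, M.run s w = some t

/-- The language accepted by the automaton. -/
def accepts {A S : Type*} (M : Automaton A S) : Language A :=
  {w | M.run M.start w = some M.final}

/-- Some arrow that enters `s` has the label `a`. -/
def HasType {A S : Type*} (M : Automaton A S) (s : S) (a : A) : Prop :=
  ∃ r : S, M.step r a = some s

/-- The inverse of a letter. -/
def invLetter {X : Type*} (a : X × Bool) : X × Bool := (a.1, !a.2)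

/-- Special automata over the free group. (That there is only one final state is built into
`Automaton`.) -/
structure IsSpecial {X S : Type*} (M : Automaton (X × Bool) S) : Prop where
  /-- The initial state has no in-edges. -/
  start_no_inedge : ∀ s a, M.step s a ≠ some M.start
  /-- There are no inaccessible states. -/
  accessible : ∀ s, M.Reaches M.start s
  /-- From every state there is a directed path to the final state. -/
  coaccessible : ∀ s, M.Reaches s M.final
  /-- All arrows that enter a given state have the same label. -/
  type_unique : ∀ s a b, M.HasType s a → M.HasType s b → a = b
  /-- No arrow that exits from a state of type `a` has the label `a⁻¹`. -/
  no_inverse : ∀ s a, M.HasType s a → M.step s (invLetter a) = none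

theorem run_append_singleton {A S : Type*} (M : Automaton A S) (s t u : S) (w : List A) (a : A)
    (h : M.run s w = some t) (h' : M.step t a = some u) : M.run s (w ++ [a]) = some u := by
  induction w generalizing s with
  | nil =>
    simp only [run, Option.some.injEq] at h
    subst h
    simp [run, h']
  | cons b w ih =>
    simp only [run, Option.bind_eq_some_iff, List.cons_append] at h ⊢
    obtain ⟨r, hr, hr'⟩ := h
    exact ⟨r, hr, ih r hr'⟩

theorem Reaches.step {A S : Type*} {M : Automaton A S} {s t u : S} {a : A}
    (h : M.Reaches s t) (h' : M.step t a = some u) : M.Reaches s u := by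
  obtain ⟨w, hw⟩ := h
  exact ⟨w ++ [a], M.run_append_singleton s t u w a hw h'⟩

/-- The automaton formed by all states accessible from the final state `z₀` of `M`, with the same
arrows between them as in `M`, and with `z₀` as both the initial and the final state. -/
def second {A S : Type*} (M : Automaton A S) : Automaton A {s : S // M.Reaches M.final s} where
  step s a := (M.step s.1 a).pmap Subtype.mk fun _ ht => s.2.step ht
  start := ⟨M.final, [], rfl⟩
  final := ⟨M.final, [], rfl⟩

/-- The completeness of an automaton of second type: from every state of type `x`, arrows with all
labels from `Σ ∖ {x⁻¹}` exit. -/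
def IsComplete {X S : Type*} (M : Automaton (X × Bool) S) : Prop :=
  ∀ s x, M.HasType s x → ∀ y, y ≠ invLetter x → ∃ t, M.step s y = some t

end Automaton

/-- A thick monoid: the set of elements of the free group accepted by `M.second`, where `M` is a
finite special automaton over the free group such that at least one arrow exits from its final
state and such that `M.second` is complete. (By the last two conditions on a special automaton,
all words accepted by `M.second` are reduced, and `T` is a submonoid.) -/
def IsThickMonoid {X : Type*} [DecidableEq X] (T : Set (FreeGroup X)) : Prop :=
  ∃ (S : Type) (_ : Finite S) (M : Automaton (X × Bool) S),
    M.IsSpecial ∧ (∃ a t, M.step M.final a = some t) ∧ M.second.IsComplete ∧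
      T = {g | g.toWord ∈ M.second.accepts}

/-- The set `P` is the reduced product `w ∘ T`: there is no cancellation in any of the products
`w * t` with `t ∈ T`, and `P` is the set of these products. -/
def IsReducedProduct {X : Type*} [DecidableEq X] (w : FreeGroup X) (T P : Set (FreeGroup X)) :
    Prop :=
  (∀ t ∈ T, (w * t).norm = w.norm + t.norm) ∧ P = (fun t => w * t) '' T

end

noncomputable section

/-! ### Power series with coefficients in `[0, 1]` that represent rational functions -/

/-! A regular set is recognised by a finite automaton. Once its states also record the last letter
read, `f_(k+1)(R)` is the probability that a random walk without cancellation, begun with a uniform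
first letter, is at an accepting state after `k` further steps (`frequency_succ`). These numbers are
matrix coefficients of the powers of one operator, so `g_R` is rational by Cayley–Hamilton
(`exists_rational_genFun`). Since `0 ≤ f_k ≤ 1`, the pole at `1` is at most simple
(`exists_tendsto_residue`), and the density is the limit of `(1 - t) g_R(t)` as `t → 1` from below.

By the maximum principle the walk is absorbed by the recurrent states
(`tendsto_average_pow_indicator`). Positive density therefore forces an accepting recurrent state
`s`, reached by some reduced word `w`. The reduced closed paths at `s` form a thick monoid `T`
(`IsRecurrent.isThickMonoid`), and `w ∘ T ⊆ R`.

Conversely, completeness gives at least `(2|X| - 1) ^ n` paths of length `n` from `z₀`, and every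
state is a bounded number of steps away from `z₀` (`IsSpecial.exists_le_sum_wordCount`). So the
frequencies of `w ∘ T`, summed over windows of bounded length, stay away from `0`, and the Abel
limit is positive. -/

theorem summable_mul_pow_of_mem_Icc {f : ℕ → ℝ} (hf : ∀ k, f k ∈ Set.Icc (0 : ℝ) 1) {t : ℝ}
    (h0 : 0 ≤ t) (h1 : t < 1) : Summable fun k => f k * t ^ k :=
  Summable.of_nonneg_of_le (fun k => mul_nonneg (hf k).1 (pow_nonneg h0 k))
    (fun k => mul_le_of_le_one_left (pow_nonneg h0 k) (hf k).2)
    (summable_geometric_of_lt_one h0 h1)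

/-- Both series converge absolutely on `[0, 1)`, so the formal product is a Cauchy product of
convergent series. -/
theorem eval_mul_tsum_eq_eval {f : ℕ → ℝ} (hf : ∀ k, f k ∈ Set.Icc (0 : ℝ) 1) {p q : ℝ[X]}
    (h : (q : PowerSeries ℝ) * PowerSeries.mk f = (p : PowerSeries ℝ)) {t : ℝ}
    (h0 : 0 ≤ t) (h1 : t < 1) : q.eval t * ∑' k, f k * t ^ k = p.eval t := by
  have hpoly : ∀ r : ℝ[X], HasSum (fun k => r.coeff k * t ^ k) (r.eval t) := by
    intro r
    rw [eval_eq_sum_range]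
    refine hasSum_sum_of_ne_finset_zero fun k hk => ?_
    rw [coeff_eq_zero_of_natDegree_lt (by simpa using hk), zero_mul]
  have hq : Summable fun k => ‖q.coeff k * t ^ k‖ := (hpoly q).summable.norm
  have hs : Summable fun k => ‖f k * t ^ k‖ := (summable_mul_pow_of_mem_Icc hf h0 h1).norm
  rw [← (hpoly q).tsum_eq, tsum_mul_tsum_eq_tsum_sum_antidiagonal_of_summable_norm hq hs,
    ← (hpoly p).tsum_eq]
  refine tsum_congr fun n => ?_
  have hn := congrArg (PowerSeries.coeff n) h
  rw [PowerSeries.coeff_mul, Polynomial.coeff_coe] at hn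
  rw [← hn, Finset.sum_mul]
  refine Finset.sum_congr rfl fun x hx => ?_
  rw [Polynomial.coeff_coe, PowerSeries.coeff_mk, ← Finset.HasAntidiagonal.mem_antidiagonal.1 hx,
    pow_add]
  ring

theorem one_sub_mul_tsum_mem_Icc {f : ℕ → ℝ} (hf : ∀ k, f k ∈ Set.Icc (0 : ℝ) 1) {t : ℝ}
    (h0 : 0 ≤ t) (h1 : t < 1) : (1 - t) * ∑' k, f k * t ^ k ∈ Set.Icc (0 : ℝ) 1 := by
  have h1t : 0 < 1 - t := by linarith
  constructor
  · exact mul_nonneg h1t.le (tsum_nonneg fun k => mul_nonneg (hf k).1 (pow_nonneg h0 k))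
  · have : ∑' k, f k * t ^ k ≤ ∑' k, t ^ k :=
      (summable_mul_pow_of_mem_Icc hf h0 h1).tsum_le_tsum
        (fun k => mul_le_of_le_one_left (pow_nonneg h0 k) (hf k).2)
        (summable_geometric_of_lt_one h0 h1)
    rw [tsum_geometric_of_lt_one h0 h1] at this
    calc (1 - t) * ∑' k, f k * t ^ k ≤ (1 - t) * (1 - t)⁻¹ := by gcongr
      _ = 1 := mul_inv_cancel₀ h1t.ne'

theorem eventually_eval_ne_zero {q : ℝ[X]} (hq : q ≠ 0) (a : ℝ) :
    ∀ᶠ t in 𝓝[≠] a, q.eval t ≠ 0 := by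
  have hfin : {t | q.IsRoot t}.Finite := Polynomial.finite_setOfPred_isRoot hq
  have : ({t | q.IsRoot t} \ {a})ᶜ ∈ 𝓝 a :=
    (hfin.subset Set.sdiff_subset).isClosed.isOpen_compl.mem_nhds (by simp)
  filter_upwards [mem_nhdsWithin_of_mem_nhds this, self_mem_nhdsWithin] with t ht hta hqt
  exact ht ⟨hqt, hta⟩

theorem eventually_left_mem_Ico : ∀ᶠ t : ℝ in 𝓝[<] 1, t ∈ Set.Ico (0 : ℝ) 1 :=
  Ico_mem_nhdsLT one_pos

/-- Abelian form of the residue at `1`. -/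
theorem tendsto_one_sub_mul_tsum {f : ℕ → ℝ} (hf : ∀ k, f k ∈ Set.Icc (0 : ℝ) 1) {p q : ℝ[X]}
    (hq : q ≠ 0) (h : (q : PowerSeries ℝ) * PowerSeries.mk f = (p : PowerSeries ℝ)) {μ : ℝ}
    (hμ : Tendsto (fun t : ℝ => (t - 1) * (p.eval t / q.eval t)) (𝓝[≠] 1) (𝓝 (-μ))) :
    Tendsto (fun t : ℝ => (1 - t) * ∑' k, f k * t ^ k) (𝓝[<] 1) (𝓝 μ) := by
  have h2 := (hμ.mono_left (nhdsLT_le_nhdsNE 1)).neg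
  rw [neg_neg] at h2
  refine h2.congr' ?_
  filter_upwards [eventually_left_mem_Ico, nhdsLT_le_nhdsNE 1 (eventually_eval_ne_zero hq 1)]
    with t ht hqt
  rw [← eval_mul_tsum_eq_eval hf h ht.1 ht.2]
  field_simp
  ring

/-- The residue at `1` of a rational function exists if its expansion at `0` has coefficients in
`[0, 1]`. -/
theorem exists_tendsto_residue {f : ℕ → ℝ} (hf : ∀ k, f k ∈ Set.Icc (0 : ℝ) 1) {p q : ℝ[X]}
    (hq : q ≠ 0) (h : (q : PowerSeries ℝ) * PowerSeries.mk f = (p : PowerSeries ℝ)) :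
    ∃ μ : ℝ, Tendsto (fun t : ℝ => (t - 1) * (p.eval t / q.eval t)) (𝓝[≠] 1) (𝓝 (-μ)) := by
  rcases eq_or_ne p 0 with rfl | hp
  · exact ⟨0, by simp⟩
  obtain ⟨p', hp', hp1⟩ := p.exists_eq_pow_rootMultiplicity_mul_and_not_dvd hp 1
  obtain ⟨q', hq', hq1⟩ := q.exists_eq_pow_rootMultiplicity_mul_and_not_dvd hq 1
  set a := p.rootMultiplicity 1
  set b := q.rootMultiplicity 1
  rw [dvd_iff_isRoot, IsRoot.def] at hp1 hq1
  have hpe : ∀ t, p.eval t = (t - 1) ^ a * p'.eval t := fun t => by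
    conv_lhs => rw [hp']
    simp
  have hqe : ∀ t, q.eval t = (t - 1) ^ b * q'.eval t := fun t => by
    conv_lhs => rw [hq']
    simp
  rcases le_or_gt b (a + 1) with hab | hab
  · obtain ⟨c, hc⟩ := Nat.exists_eq_add_of_le hab
    have hcont : ContinuousAt (fun t : ℝ => (t - 1) ^ c * (p'.eval t / q'.eval t)) 1 := by
      have h1 : ContinuousAt (fun t : ℝ => p'.eval t) 1 := p'.continuous.continuousAt
      have h2 : ContinuousAt (fun t : ℝ => q'.eval t) 1 := q'.continuous.continuousAt
      exact (by fun_prop : ContinuousAt (fun t : ℝ => (t - 1) ^ c) 1).mul (h1.div h2 hq1)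
    -- Here `a + 1 = b + c`. For `c = 0` the pole is simple and the convention `0 ^ 0 = 1` gives its
    -- residue; for `c > 0` there is no pole and the value is `0`.
    refine ⟨-((1 - 1) ^ c * (p'.eval 1 / q'.eval 1)), ?_⟩
    rw [neg_neg]
    refine (hcont.tendsto.mono_left nhdsWithin_le_nhds).congr' ?_
    filter_upwards [self_mem_nhdsWithin] with t ht
    have ht1 : t - 1 ≠ 0 := sub_ne_zero.2 ht
    rw [hpe, hqe, ← mul_div_assoc, ← mul_div_assoc, ← mul_assoc, ← pow_succ', hc, pow_add,
      mul_assoc, mul_div_mul_left _ _ (pow_ne_zero _ ht1)]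
  · exfalso
    obtain ⟨c, hc⟩ := Nat.exists_eq_add_of_lt hab
    -- The pole would have order `b - a = c + 2`, but `(1 - t)` times the sum stays in `[0, 1]`. The
    -- surplus factor then forces `p'` to vanish at `1`.
    have hle : ∀ᶠ t in 𝓝[<] (1 : ℝ), |p'.eval t| ≤ |t - 1| ^ (c + 1) * |q'.eval t| := by
      filter_upwards [eventually_left_mem_Ico] with t ht
      have hS := one_sub_mul_tsum_mem_Icc hf ht.1 ht.2
      have he := eval_mul_tsum_eq_eval hf h ht.1 ht.2
      have ht1 : 0 < |t - 1| := abs_pos.2 (by linarith [ht.2])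
      set S := ∑' k, f k * t ^ k
      rw [hpe, hqe] at he
      have hS' : |t - 1| * |S| ≤ 1 := by
        rw [← abs_mul, abs_le]
        constructor <;> nlinarith [hS.1, hS.2]
      have he' : |t - 1| ^ b * |q'.eval t| * |S| = |t - 1| ^ a * |p'.eval t| := by
        rw [← abs_pow, ← abs_pow, ← abs_mul, ← abs_mul, ← abs_mul, he]
      have hb : b = a + (c + 1) + 1 := by omega
      have h3 : |p'.eval t| = |t - 1| ^ (c + 1) * |q'.eval t| * (|t - 1| * |S|) := by
        have hane : |t - 1| ^ a ≠ 0 := (pow_pos ht1 a).ne'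
        apply mul_left_cancel₀ hane
        rw [← he', hb]
        ring
      rw [h3]
      exact mul_le_of_le_one_right (by positivity) hS'
    have hl : Tendsto (fun t : ℝ => |p'.eval t|) (𝓝[<] 1) (𝓝 |p'.eval 1|) :=
      (p'.continuous.abs.tendsto 1).mono_left nhdsWithin_le_nhds
    have hr : Tendsto (fun t : ℝ => |t - 1| ^ (c + 1) * |q'.eval t|) (𝓝[<] 1)
        (𝓝 (|(1 : ℝ) - 1| ^ (c + 1) * |q'.eval 1|)) := by
      have : Continuous fun t : ℝ => |t - 1| ^ (c + 1) * |q'.eval t| :=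
        (by fun_prop : Continuous fun t : ℝ => |t - 1| ^ (c + 1)).mul q'.continuous.abs
      exact (this.tendsto 1).mono_left nhdsWithin_le_nhds
    have := le_of_tendsto_of_tendsto hl hr hle
    simp only [sub_self, abs_zero, ne_eq, Nat.add_eq_zero_iff, one_ne_zero, and_false,
      not_false_eq_true, zero_pow, zero_mul] at this
    exact hp1 (abs_eq_zero.1 (le_antisymm this (abs_nonneg _)))

/-- An Abel limit is at most every eventual upper bound of the coefficients. -/
theorem le_of_tendsto_abel_of_eventually_le {f : ℕ → ℝ} (hf : ∀ k, f k ∈ Set.Icc (0 : ℝ) 1)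
    {μ : ℝ} (hμ : Tendsto (fun t : ℝ => (1 - t) * ∑' k, f k * t ^ k) (𝓝[<] 1) (𝓝 μ))
    {ε : ℝ} {K : ℕ} (hε : 0 ≤ ε) (h : ∀ k, K ≤ k → f k ≤ ε) : μ ≤ ε := by
  -- The first `K` terms contribute at most `(1 - t) * K`, which disappears in the limit; the tail
  -- contributes at most `ε`.
  have hr : Tendsto (fun t : ℝ => (1 - t) * K + ε) (𝓝[<] 1) (𝓝 ((1 - 1) * K + ε)) := by
    have : Continuous fun t : ℝ => (1 - t) * K + ε := by fun_prop
    exact (this.tendsto 1).mono_left nhdsWithin_le_nhds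
  rw [sub_self, zero_mul, zero_add] at hr
  refine le_of_tendsto_of_tendsto hμ hr ?_
  filter_upwards [eventually_left_mem_Ico] with t ht
  have h1t : 0 < 1 - t := by linarith [ht.2]
  have hs := summable_mul_pow_of_mem_Icc hf ht.1 ht.2
  have h1 : ∑ k ∈ Finset.range K, f k * t ^ k ≤ K := by
    calc ∑ k ∈ Finset.range K, f k * t ^ k ≤ ∑ k ∈ Finset.range K, (1 : ℝ) :=
          Finset.sum_le_sum fun k _ =>
            mul_le_one₀ (hf k).2 (pow_nonneg ht.1 k) (pow_le_one₀ ht.1 ht.2.le)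
      _ = K := by simp
  have h2 : ∑' k, f (k + K) * t ^ (k + K) ≤ ε * (1 - t)⁻¹ := by
    rw [← tsum_geometric_of_lt_one ht.1 ht.2, ← tsum_mul_left]
    refine ((summable_nat_add_iff K).2 hs).tsum_le_tsum (fun k => ?_)
      ((summable_geometric_of_lt_one ht.1 ht.2).mul_left ε)
    exact mul_le_mul (h _ (Nat.le_add_left _ _))
      (pow_le_pow_of_le_one ht.1 ht.2.le (Nat.le_add_right _ _)) (pow_nonneg ht.1 _) hε
  rw [← hs.sum_add_tsum_nat_add K]
  calc (1 - t) * (∑ k ∈ Finset.range K, f k * t ^ k + ∑' k, f (k + K) * t ^ (k + K))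
      ≤ (1 - t) * (K + ε * (1 - t)⁻¹) := by gcongr
    _ = (1 - t) * K + ε := by field_simp

/-- If the sums of the coefficients over all late windows of length `N` are at least `ε`, then the
Abel limit is at least `ε / N`. -/
theorem le_mul_of_tendsto_abel_of_le_sum {f : ℕ → ℝ} (hf : ∀ k, f k ∈ Set.Icc (0 : ℝ) 1)
    {μ : ℝ} (hμ : Tendsto (fun t : ℝ => (1 - t) * ∑' k, f k * t ^ k) (𝓝[<] 1) (𝓝 μ))
    {ε : ℝ} {K N : ℕ} (h : ∀ m, K ≤ m → ε ≤ ∑ j ∈ Finset.range N, f (m + j)) :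
    ε ≤ N * μ := by
  -- Add up the `N` shifted tails, each at most the whole series, and regroup them by windows. All
  -- exponents in the window starting at `m + K` are below `m + K + N`, which accounts for the
  -- factor `t ^ (K + N)`.
  have hl : Tendsto (fun t : ℝ => ε * t ^ (K + N)) (𝓝[<] 1) (𝓝 (ε * 1 ^ (K + N))) := by
    have : Continuous fun t : ℝ => ε * t ^ (K + N) := by fun_prop
    exact (this.tendsto 1).mono_left nhdsWithin_le_nhds
  rw [one_pow, mul_one] at hl
  refine le_of_tendsto_of_tendsto hl (hμ.const_mul (N : ℝ)) ?_
  filter_upwards [eventually_left_mem_Ico] with t ht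
  have h1t : 0 < 1 - t := by linarith [ht.2]
  have hs := summable_mul_pow_of_mem_Icc hf ht.1 ht.2
  have hshift : ∀ j, Summable fun m => f (m + (K + j)) * t ^ (m + (K + j)) := fun j =>
    (summable_nat_add_iff (K + j)).2 hs
  have h1 : ∑ j ∈ Finset.range N, ∑' m, f (m + (K + j)) * t ^ (m + (K + j)) ≤
      N * ∑' k, f k * t ^ k := by
    rw [← nsmul_eq_mul]
    conv_rhs => rw [← Finset.card_range N]
    refine Finset.sum_le_card_nsmul _ _ _ fun j _ => ?_
    rw [← hs.sum_add_tsum_nat_add (K + j)]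
    exact le_add_of_nonneg_left
      (Finset.sum_nonneg fun k _ => mul_nonneg (hf k).1 (pow_nonneg ht.1 k))
  have h2 : ε * t ^ (K + N) * (1 - t)⁻¹ ≤
      ∑ j ∈ Finset.range N, ∑' m, f (m + (K + j)) * t ^ (m + (K + j)) := by
    rw [← Summable.tsum_finsetSum fun j _ => hshift j, ← tsum_geometric_of_lt_one ht.1 ht.2,
      ← tsum_mul_left]
    refine ((summable_geometric_of_lt_one ht.1 ht.2).mul_left _).tsum_le_tsum (fun m => ?_)
      (summable_sum fun j _ => hshift j)
    calc ε * t ^ (K + N) * t ^ m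
        ≤ (∑ j ∈ Finset.range N, f (m + K + j)) * t ^ (m + (K + N)) := by
          rw [mul_assoc, ← pow_add, add_comm (K + N)]
          exact mul_le_mul_of_nonneg_right (h _ (Nat.le_add_left _ _)) (pow_nonneg ht.1 _)
      _ ≤ ∑ j ∈ Finset.range N, f (m + (K + j)) * t ^ (m + (K + j)) := by
          rw [Finset.sum_mul]
          refine Finset.sum_le_sum fun j hj => ?_
          rw [add_assoc]
          refine mul_le_mul_of_nonneg_left (pow_le_pow_of_le_one ht.1 ht.2.le ?_) (hf _).1
          have := Finset.mem_range.1 hj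
          omega
  calc ε * t ^ (K + N) = (1 - t) * (ε * t ^ (K + N) * (1 - t)⁻¹) := by field_simp
    _ ≤ (1 - t) * (N * ∑' k, f k * t ^ k) := mul_le_mul_of_nonneg_left (h2.trans h1) h1t.le
    _ = N * ((1 - t) * ∑' k, f k * t ^ k) := by ring

/-- A sequence whose terms are matrix coefficients of the powers of an endomorphism of a
finite-dimensional space has a rational generating function. -/
theorem exists_rational_genFun {E : Type*} [AddCommGroup E] [Module ℝ E] [FiniteDimensional ℝ E]
    (P : E →ₗ[ℝ] E) (l : E →ₗ[ℝ] ℝ) (v : E) (f : ℕ → ℝ)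
    (hf : ∀ k, f (k + 1) = l ((P ^ k) v)) :
    ∃ p q : ℝ[X], q ≠ 0 ∧ (q : PowerSeries ℝ) * PowerSeries.mk f = (p : PowerSeries ℝ) := by
  set c := P.charpoly
  set D := c.natDegree
  have hc : c ≠ 0 := P.charpoly_monic.ne_zero
  have hrec : ∀ m, ∑ i ∈ Finset.range (D + 1), c.coeff i * f (m + i + 1) = 0 := by
    intro m
    have h1 : aeval P c = 0 := P.aeval_self_charpoly
    rw [aeval_eq_sum_range] at h1
    have h2 := congrArg (fun Q : E →ₗ[ℝ] E => l ((P ^ m) (Q v))) h1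
    simp only [LinearMap.sum_apply, map_sum, LinearMap.smul_apply, map_smul, smul_eq_mul,
      LinearMap.zero_apply, map_zero] at h2
    rw [← h2]
    refine Finset.sum_congr rfl fun i _ => ?_
    rw [hf, pow_add]
    rfl
  -- Reversing the characteristic polynomial turns the recurrence into a vanishing convolution. As
  -- `f 0` is not covered by the recurrence, the product has zero coefficients only from degree `D +
  -- 1` on, and its truncation there is the numerator.
  set q := c.reflect D
  refine ⟨PowerSeries.trunc (D + 1) ((q : PowerSeries ℝ) * PowerSeries.mk f), q, ?_, ?_⟩
  · simpa [q, reflect_eq_zero_iff] using hc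
  · ext n
    rw [Polynomial.coeff_coe, PowerSeries.coeff_trunc]
    split_ifs with hn
    · rfl
    · obtain ⟨m, rfl⟩ := Nat.exists_eq_add_of_le (not_lt.1 hn)
      rw [PowerSeries.coeff_mul, Finset.Nat.sum_antidiagonal_eq_sum_range_succ_mk,
        ← hrec m]
      have hsub : Finset.range (D + 1) ⊆ Finset.range (D + 1 + m + 1) :=
        Finset.range_mono (by omega)
      rw [← Finset.sum_subset hsub, ← Finset.sum_range_reflect]
      · refine Finset.sum_congr rfl fun i hi => ?_
        have hi := Finset.mem_range.1 hi
        rw [Polynomial.coeff_coe, PowerSeries.coeff_mk, coeff_reflect,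
          revAt_le (by omega : D + 1 - 1 - i ≤ D)]
        congr 2 <;> omega
      · intro i _ hi
        have hi : D < i := by simpa using hi
        rw [Polynomial.coeff_coe, coeff_reflect, revAt_eq_self_of_lt hi,
          coeff_eq_zero_of_natDegree_lt hi, zero_mul]

/-! ### Counting words -/

/-- The number of words of length `n` with a given property. -/
def wordCount {A : Type*} (n : ℕ) (p : List A → Prop) : ℕ :=
  Set.ncard {w : List A | w.length = n ∧ p w}

theorem wordCount_congr {A : Type*} {n : ℕ} {p q : List A → Prop}
    (h : ∀ w, w.length = n → (p w ↔ q w)) : wordCount n p = wordCount n q := by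
  unfold wordCount
  congr 1
  ext w
  exact and_congr_right (h w)

open Classical in
theorem wordCount_zero {A : Type*} (p : List A → Prop) :
    wordCount 0 p = if p [] then 1 else 0 := by
  unfold wordCount
  split_ifs with h
  · rw [Set.ncard_eq_one]
    refine ⟨[], ?_⟩
    ext w
    simp only [Set.mem_ofPred_eq, Set.mem_singleton_iff, List.length_eq_zero_iff]
    exact ⟨fun hw => hw.1, fun hw => ⟨hw, hw ▸ h⟩⟩
  · convert Set.ncard_empty (List A)
    ext w
    simp only [Set.mem_ofPred_eq, Set.mem_empty_iff_false, iff_false, List.length_eq_zero_iff]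
    rintro ⟨rfl, hw⟩
    exact h hw

theorem wordCount_false {A : Type*} (n : ℕ) : wordCount n (fun _ : List A => False) = 0 := by
  simp [wordCount]

theorem finite_wordCount {A : Type*} [Finite A] (n : ℕ) (p : List A → Prop) :
    {w : List A | w.length = n ∧ p w}.Finite :=
  (List.finite_length_eq A n).subset fun _ h => h.1

/-- Counting by the first letter. -/
theorem wordCount_succ {A : Type*} [Fintype A] (n : ℕ) (p : List A → Prop) :
    wordCount (n + 1) p = ∑ b, wordCount n fun w => p (b :: w) := by
  have hfin : ∀ b, Finite {w : List A | w.length = n ∧ p (b :: w)} := fun b =>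
    (finite_wordCount n _).to_subtype
  unfold wordCount
  simp only [← Nat.card_coe_set_eq]
  rw [← Nat.card_sigma]
  refine (Nat.card_congr (Equiv.ofBijective
    (fun x : Σ b, {w : List A | w.length = n ∧ p (b :: w)} =>
      (⟨x.1 :: x.2.1, by simpa using x.2.2.1, x.2.2.2⟩ : {w : List A | w.length = n + 1 ∧ p w}))
    ⟨?_, ?_⟩)).symm
  · rintro ⟨b, w, hw⟩ ⟨c, v, hv⟩ h
    simp only [Subtype.mk.injEq, List.cons.injEq] at h
    obtain ⟨rfl, rfl⟩ := h
    rfl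
  · rintro ⟨_ | ⟨b, w⟩, hl, hw⟩
    · simp at hl
    · exact ⟨⟨b, w, by simpa using hl, hw⟩, rfl⟩

/-! ### Reduced words and the sizes of spheres -/

section FreeGroup

variable {X : Type*}

open Automaton FreeGroup

theorem isReduced_cons_cons_iff {a b : X × Bool} {w : List (X × Bool)} :
    IsReduced (a :: b :: w) ↔ b ≠ invLetter a ∧ IsReduced (b :: w) := by
  unfold FreeGroup.IsReduced
  rw [List.isChain_cons_cons]
  refine and_congr_left fun _ => ?_
  obtain ⟨x, i⟩ := a
  obtain ⟨y, j⟩ := b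
  simp only [invLetter, ne_eq, Prod.mk.injEq, not_and]
  constructor
  · rintro h rfl h'
    have := h rfl
    subst this
    cases i <;> simp at h'
  · rintro h rfl
    have := h rfl
    revert this
    cases i <;> cases j <;> simp

/-- Keeping the preceding letter in front makes reducedness a condition on the next letter alone;
this recursion drives the walk below. -/
theorem wordCount_reduced_cons [Fintype X] [DecidableEq X] (n : ℕ) (a : X × Bool)
    (p : List (X × Bool) → Prop) :
    wordCount (n + 1) (fun w => IsReduced (a :: w) ∧ p w) =
      ∑ b with b ≠ invLetter a, wordCount n fun w => IsReduced (b :: w) ∧ p (b :: w) := by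
  rw [wordCount_succ, Finset.sum_filter]
  refine Finset.sum_congr rfl fun b _ => ?_
  split_ifs with h
  · exact wordCount_congr fun w _ => by rw [isReduced_cons_cons_iff, and_iff_right h]
  · rw [← wordCount_false (A := X × Bool) n]
    exact wordCount_congr fun w _ => by
      rw [isReduced_cons_cons_iff]
      exact ⟨fun hw => h hw.1.1, False.elim⟩

/-- The number of letters that may follow a given letter in a reduced word. -/
def branching (X : Type*) [Fintype X] : ℕ := Fintype.card (X × Bool) - 1

theorem card_ne_invLetter [Fintype X] [DecidableEq X] (a : X × Bool) :
    (Finset.univ.filter fun b => b ≠ invLetter a).card = branching X := by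
  rw [Finset.filter_ne', Finset.card_erase_of_mem (Finset.mem_univ _)]
  rfl

theorem branching_pos [Fintype X] (a : X × Bool) : 0 < branching X := by
  have : 0 < Fintype.card X := Fintype.card_pos_iff.2 ⟨a.1⟩
  simp only [branching, Fintype.card_prod, Fintype.card_bool]
  omega

theorem wordCount_isReduced_cons [Fintype X] (n : ℕ) (a : X × Bool) :
    wordCount n (fun w => IsReduced (a :: w)) = branching X ^ n := by
  classical
  induction n generalizing a with
  | zero => rw [wordCount_zero, if_pos IsReduced.singleton, pow_zero]
  | succ n ih =>
    have h := wordCount_reduced_cons n a fun _ => True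
    simp only [and_true, ih, Finset.sum_const, card_ne_invLetter, smul_eq_mul] at h
    rw [h, pow_succ']

variable [DecidableEq X]

theorem ncard_inter_freeSphere (R : Set (FreeGroup X)) (k : ℕ) :
    (R ∩ freeSphere X k).ncard = wordCount k fun w => w ∈ toWord '' R := by
  rw [← Set.ncard_image_of_injective _ toWord_injective]
  unfold wordCount
  congr 1
  ext w
  simp only [Set.mem_image, Set.mem_inter_iff, freeSphere, Set.mem_ofPred_eq]
  constructor
  · rintro ⟨g, ⟨hg, hk⟩, rfl⟩
    exact ⟨hk, g, hg, rfl⟩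
  · rintro ⟨hk, g, hg, rfl⟩
    exact ⟨g, ⟨hg, hk⟩, rfl⟩

theorem ncard_freeSphere_succ [Fintype X] (k : ℕ) :
    (freeSphere X (k + 1)).ncard = Fintype.card (X × Bool) * branching X ^ k := by
  rw [← Set.univ_inter (freeSphere X (k + 1)), ncard_inter_freeSphere, wordCount_succ]
  have : ∀ b : X × Bool, (wordCount k fun w => b :: w ∈ toWord '' (Set.univ : Set (FreeGroup X))) =
      branching X ^ k := fun b => by
    rw [← wordCount_isReduced_cons k b]
    refine wordCount_congr fun w _ => ⟨?_, fun h => ⟨mk (b :: w), trivial, ?_⟩⟩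
    · rintro ⟨g, -, hg⟩
      exact hg ▸ isReduced_toWord
    · rw [toWord_mk, h.reduce_eq]
  simp only [this, Finset.sum_const, Finset.card_univ, smul_eq_mul]

theorem finite_freeSphere [Finite X] (k : ℕ) : (freeSphere X k).Finite := by
  refine ((List.finite_length_eq (X × Bool) k).preimage toWord_injective.injOn).subset ?_
  exact fun g hg => hg

theorem frequency_mem_Icc [Finite X] (R : Set (FreeGroup X)) (k : ℕ) :
    frequency R k ∈ Set.Icc (0 : ℝ) 1 := by
  refine ⟨by unfold frequency; positivity, div_le_one_of_le₀ ?_ (Nat.cast_nonneg _)⟩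
  exact_mod_cast Set.ncard_le_ncard Set.inter_subset_right (finite_freeSphere k)

end FreeGroup

/-! ### Reduced words read by an automaton that remembers the last letter -/

/-- A complete deterministic automaton over the letters of a free group each of whose states
determines the label of the arrows that enter it. -/
structure LetterAutomaton (X V : Type*) where
  label : V → X × Bool
  next : V → X × Bool → V
  label_next : ∀ v b, label (next v b) = b

namespace LetterAutomaton

open Automaton FreeGroup

variable {X V : Type*} (L : LetterAutomaton X V)

/-- The state reached from `v` along a word. -/
def eval (v : V) (w : List (X × Bool)) : V := w.foldl L.next v

/-- There is an arrow from `v` to `u` that can be taken without cancellation. -/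
def Adj (v u : V) : Prop := ∃ b, b ≠ invLetter (L.label v) ∧ L.next v b = u

/-- There is a path without cancellation from `v` to `u`. -/
def Reach : V → V → Prop := Relation.ReflTransGen L.Adj

/-- A state is recurrent if one can return to it from wherever one can go. -/
def IsRecurrent (v : V) : Prop := ∀ u, L.Reach v u → L.Reach u v

theorem IsRecurrent.of_reach {v u : V} (h : L.IsRecurrent v) (hvu : L.Reach v u) :
    L.IsRecurrent u := fun t hut => (h t (hvu.trans hut)).trans hvu

/-- Among the states reachable from `v`, take one from which the fewest states are reachable. Moving
on cannot shrink that set, so the way back stays open. -/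
theorem exists_reach_isRecurrent [Finite V] (v : V) : ∃ u, L.Reach v u ∧ L.IsRecurrent u := by
  have hex : ∃ n, ∃ u, L.Reach v u ∧ {t | L.Reach u t}.ncard = n := ⟨_, v, .refl, rfl⟩
  classical
  obtain ⟨u, hvu, hu⟩ := Nat.find_spec hex
  refine ⟨u, hvu, fun t hut => ?_⟩
  have hsub : {s | L.Reach t s} ⊆ {s | L.Reach u s} := fun s hs => Relation.ReflTransGen.trans hut hs
  have hle : {s | L.Reach u s}.ncard ≤ {s | L.Reach t s}.ncard :=
    hu ▸ Nat.find_min' hex ⟨t, hvu.trans hut, rfl⟩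
  have := Set.eq_of_subset_of_ncard_le hsub hle (Set.toFinite _)
  exact this.symm.subset (Relation.ReflTransGen.refl : L.Reach u u)

/-- Quantifying over the continuation `y` records that nothing cancels where the path is prolonged.
-/
theorem Reach.exists_word {v u : V} (h : L.Reach v u) :
    ∃ w, L.eval v w = u ∧
      ∀ y, IsReduced (L.label u :: y) → IsReduced (L.label v :: (w ++ y)) := by
  induction h with
  | refl => exact ⟨[], rfl, fun y hy => hy⟩
  | @tail s u _ hsu ih =>
    obtain ⟨b, hb, rfl⟩ := hsu
    obtain ⟨w, rfl, hw⟩ := ih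
    refine ⟨w ++ [b], by simp [eval], fun y hy => ?_⟩
    rw [L.label_next] at hy
    rw [List.append_assoc]
    exact hw _ (isReduced_cons_cons_iff.2 ⟨hb, hy⟩)

/-! ### The random walk without cancellation and its absorption -/

variable [Fintype X] [DecidableEq X]

/-- The averaging operator of the uniform random walk without cancellation. -/
def average : (V → ℝ) →ₗ[ℝ] (V → ℝ) where
  toFun φ v := (∑ b with b ≠ invLetter (L.label v), φ (L.next v b)) / branching X
  map_add' φ ψ := by
    ext v
    simp [Finset.sum_add_distrib, add_div]
  map_smul' c φ := by
    ext v
    simp [← Finset.mul_sum, mul_div_assoc]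

theorem average_apply (φ : V → ℝ) (v : V) :
    L.average φ v = (∑ b with b ≠ invLetter (L.label v), φ (L.next v b)) / branching X := rfl

theorem average_pow_succ (n : ℕ) (φ : V → ℝ) :
    (L.average ^ (n + 1)) φ = L.average ((L.average ^ n) φ) := by
  rw [pow_succ']
  rfl

-- Each letter has exactly `branching X` admissible successors, so a count of paths is a probability
-- of the walk times a power of that number.
open Classical in
theorem wordCount_eval (n : ℕ) (v : V) (A : Set V) :
    (wordCount n (fun w => IsReduced (L.label v :: w) ∧ L.eval v w ∈ A) : ℝ) =
      branching X ^ n * (L.average ^ n) (A.indicator 1) v := by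
  induction n generalizing v with
  | zero =>
    rw [wordCount_zero]
    by_cases h : v ∈ A <;> simp [h, eval, IsReduced.singleton]
  | succ n ih =>
    rw [wordCount_reduced_cons, average_pow_succ, average_apply, Nat.cast_sum]
    have hd : (branching X : ℝ) ≠ 0 := by exact_mod_cast (branching_pos (L.label v)).ne'
    rw [pow_succ, mul_assoc, mul_div_cancel₀ _ hd, Finset.mul_sum]
    refine Finset.sum_congr rfl fun b _ => ?_
    rw [← ih, L.label_next]
    rfl

theorem average_pow_le_average_pow {φ ψ : V → ℝ} (n : ℕ) (v : V)
    (h : ∀ u, L.Reach v u → φ u ≤ ψ u) : (L.average ^ n) φ v ≤ (L.average ^ n) ψ v := by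
  induction n generalizing v with
  | zero => exact h v .refl
  | succ n ih =>
    rw [average_pow_succ, average_pow_succ, average_apply, average_apply]
    gcongr with b hb
    exact ih _ fun u hu => h u (.head ⟨b, (Finset.mem_filter.1 hb).2, rfl⟩ hu)

theorem average_one (v : V) : L.average 1 v = 1 := by
  have hd : (branching X : ℝ) ≠ 0 := by exact_mod_cast (branching_pos (L.label v)).ne'
  simp [average_apply, card_ne_invLetter, hd]

/-- The maximum principle: a harmonic function that vanishes at the recurrent states is at most
`0`. -/
theorem le_zero_of_average_eq [Finite V] {ψ : V → ℝ} (h : L.average ψ = ψ)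
    (h0 : ∀ v, L.IsRecurrent v → ψ v = 0) (v : V) : ψ v ≤ 0 := by
  have : Nonempty V := ⟨v⟩
  obtain ⟨m, hm⟩ := Finite.exists_max ψ
  -- Where the maximum is attained, it is an average of values that do not exceed it, so all
  -- successors attain it too. Following arrows carries it to a recurrent state.
  have hstep : ∀ u, ψ u = ψ m → ∀ t, L.Adj u t → ψ t = ψ m := by
    rintro u hu t ⟨b, hb, rfl⟩
    have hd : (branching X : ℝ) ≠ 0 := by exact_mod_cast (branching_pos (L.label u)).ne'
    have hsum : ∑ b with b ≠ invLetter (L.label u), ψ (L.next u b) =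
        ∑ b with b ≠ invLetter (L.label u), ψ m := by
      have h1 := congrFun h u
      rw [average_apply, div_eq_iff hd, hu] at h1
      rw [h1, Finset.sum_const, card_ne_invLetter, nsmul_eq_mul, mul_comm]
    exact (Finset.sum_eq_sum_iff_of_le fun b _ => hm _).1 hsum b (by simpa using hb)
  obtain ⟨u, hmu, hu⟩ := L.exists_reach_isRecurrent m
  have hum : ψ u = ψ m := by
    clear hu
    induction hmu with
    | refl => rfl
    | tail _ hst ih => exact hstep _ ih _ hst
  rw [← h0 u hu, hum]
  exact hm v

/-- The walk is eventually absorbed by the recurrent states. -/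
theorem tendsto_average_pow_indicator [Finite V] (v : V) :
    Tendsto (fun n => (L.average ^ n) ({u | ¬L.IsRecurrent u}.indicator 1) v) atTop (𝓝 0) := by
  set φ : V → ℝ := {u | ¬L.IsRecurrent u}.indicator 1 with hφ
  have hφ0 : ∀ u, 0 ≤ φ u := fun u => Set.indicator_nonneg (fun _ _ => zero_le_one) u
  have hφ1 : ∀ u, φ u ≤ 1 := fun u => Set.indicator_le_self' (fun _ _ => zero_le_one) u
  have hpos : ∀ n u, 0 ≤ (L.average ^ n) φ u := fun n u => by
    have := L.average_pow_le_average_pow (φ := 0) n u fun t _ => hφ0 t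
    simpa using this
  have hφrec : ∀ u, L.IsRecurrent u → φ u = 0 := fun u hu =>
    Set.indicator_of_notMem (by simpa using hu) _
  have hrec : ∀ n u, L.IsRecurrent u → (L.average ^ n) φ u = 0 := fun n u hu => by
    refine le_antisymm ?_ (hpos n u)
    have := L.average_pow_le_average_pow (ψ := 0) n u
      fun t ht => (hφrec t (hu.of_reach L ht)).le
    simpa using this
  -- `φ` is superharmonic: recurrence is inherited along arrows, and elsewhere `φ` has its largest
  -- possible value `1`. The iterates therefore decrease, and their limit is harmonic.
  have hstep : ∀ u, L.average φ u ≤ φ u := fun u => by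
    by_cases hu : L.IsRecurrent u
    · exact (hrec 1 u hu).le.trans (hφ0 u)
    · have h1 : φ u = 1 := Set.indicator_of_mem (s := {u | ¬L.IsRecurrent u}) hu _
      rw [h1, ← L.average_one u]
      exact L.average_pow_le_average_pow 1 u fun t _ => hφ1 t
  have hanti : ∀ u, Antitone fun n => (L.average ^ n) φ u := fun u =>
    antitone_nat_of_succ_le fun n => by
      rw [pow_succ]
      exact L.average_pow_le_average_pow n u fun t _ => hstep t
  have hlim : ∀ u, ∃ l, Tendsto (fun n => (L.average ^ n) φ u) atTop (𝓝 l) := fun u =>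
    ⟨_, tendsto_atTop_ciInf (hanti u) ⟨0, by rintro _ ⟨n, rfl⟩; exact hpos n u⟩⟩
  choose ψ hψ using hlim
  have hharm : L.average ψ = ψ := by
    ext u
    refine tendsto_nhds_unique ?_ ((tendsto_add_atTop_iff_nat 1).2 (hψ u))
    simp only [average_pow_succ, average_apply]
    exact (tendsto_finsetSum _ fun b _ => hψ _).div_const _
  have hψ0 : ψ v = 0 := by
    refine le_antisymm (L.le_zero_of_average_eq hharm (fun u hu => ?_) v)
      (ge_of_tendsto' (hψ v) fun n => hpos n v)
    refine tendsto_nhds_unique (hψ u) ?_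
    simp [hrec _ u hu]
  exact hψ0 ▸ hψ v

end LetterAutomaton

section Thick

open Automaton FreeGroup
-- The density of a regular set
section Regular

variable {X : Type*} [DecidableEq X]

theorem IsRegularSubset.exists_letterAutomaton [Finite X] {R : Set (FreeGroup X)}
    (hR : IsRegularSubset R) :
    ∃ (V : Type) (_ : Finite V) (L : LetterAutomaton X V) (init : X × Bool → V) (A : Set V),
      (∀ a, L.label (init a) = a) ∧
        ∀ a w, a :: w ∈ toWord '' R ↔ FreeGroup.IsReduced (a :: w) ∧ L.eval (init a) w ∈ A := by
  obtain ⟨σ, _, D, hD⟩ := hR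
  -- Letters are coded by `Fin m` so that the states lie in `Type`, as the definition of a thick
  -- monoid requires, whatever the universe of `X`.
  obtain ⟨m, ⟨e⟩⟩ := Finite.exists_equiv_fin (X × Bool)
  let L : LetterAutomaton X (σ × Fin m) :=
    ⟨fun v => e.symm v.2, fun v b => (D.step v.1 b, e b), fun v b => e.symm_apply_apply b⟩
  have heval : ∀ w v, (L.eval v w).1 = D.evalFrom v.1 w := by
    intro w
    induction w with
    | nil => exact fun v => rfl
    | cons b w ih => exact fun v => ih _
  refine ⟨σ × Fin m, inferInstance, L, fun a => (D.step D.start a, e a), {v | v.1 ∈ D.accept},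
    fun a => e.symm_apply_apply a, fun a w => ?_⟩
  have hmem : a :: w ∈ toWord '' R ↔ D.evalFrom (D.step D.start a) w ∈ D.accept := by
    rw [← hD]
    rfl
  rw [Set.mem_ofPred_eq, heval, ← hmem]
  refine ⟨fun h => ⟨?_, h⟩, fun h => h.2⟩
  obtain ⟨g, -, hg⟩ := h
  exact hg ▸ isReduced_toWord

/-- The factor `branching X ^ k` occurs both in the count and in the size of the sphere, and
cancels. The first letter is treated apart because it has no predecessor. -/
theorem frequency_succ [Fintype X] {V : Type*} (L : LetterAutomaton X V) {init : X × Bool → V}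
    {A : Set V} (hinit : ∀ a, L.label (init a) = a) {R : Set (FreeGroup X)}
    (hR : ∀ a w, a :: w ∈ toWord '' R ↔ FreeGroup.IsReduced (a :: w) ∧ L.eval (init a) w ∈ A)
    (k : ℕ) : frequency R (k + 1) =
      (∑ a, (L.average ^ k) (A.indicator 1) (init a)) / Fintype.card (X × Bool) := by
  have hcount : ((R ∩ freeSphere X (k + 1)).ncard : ℝ) =
      branching X ^ k * ∑ a, (L.average ^ k) (A.indicator 1) (init a) := by
    rw [ncard_inter_freeSphere, wordCount_succ, Nat.cast_sum, Finset.mul_sum]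
    refine Finset.sum_congr rfl fun a _ => ?_
    rw [← L.wordCount_eval, hinit]
    simp only [hR]
  rw [frequency, hcount, ncard_freeSphere_succ]
  push_cast
  rcases isEmpty_or_nonempty (X × Bool) with h | ⟨⟨a⟩⟩
  · simp
  · have hd : (branching X : ℝ) ^ k ≠ 0 :=
      pow_ne_zero _ (by exact_mod_cast (branching_pos a).ne')
    rw [mul_comm (branching X ^ k : ℝ), mul_div_mul_right _ _ hd]

/-- Every regular subset of the free group has a Cesaro density. -/
theorem IsRegularSubset.exists_hasCesaroDensity [Finite X] {R : Set (FreeGroup X)}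
    (hR : IsRegularSubset R) : ∃ μ : ℝ, HasCesaroDensity R μ := by
  have := Fintype.ofFinite X
  obtain ⟨V, _, L, init, A, hinit, hA⟩ := hR.exists_letterAutomaton
  have hf : ∀ k, frequency R (k + 1) =
      ((Fintype.card (X × Bool) : ℝ)⁻¹ • ∑ a, LinearMap.proj (R := ℝ) (init a) :
        (V → ℝ) →ₗ[ℝ] ℝ) ((L.average ^ k) (A.indicator 1)) := fun k => by
    rw [frequency_succ L hinit hA, LinearMap.smul_apply, LinearMap.sum_apply, div_eq_inv_mul]
    rfl
  obtain ⟨p, q, hq, h⟩ := exists_rational_genFun _ _ _ _ hf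
  obtain ⟨μ, hμ⟩ := exists_tendsto_residue (frequency_mem_Icc R) hq h
  exact ⟨μ, p, q, hq, h, hμ⟩

theorem HasCesaroDensity.tendsto_abel [Finite X] {R : Set (FreeGroup X)} {μ : ℝ}
    (h : HasCesaroDensity R μ) :
    Tendsto (fun t : ℝ => (1 - t) * ∑' k, frequency R k * t ^ k) (𝓝[<] 1) (𝓝 μ) := by
  obtain ⟨p, q, hq, hpq, hμ⟩ := h
  exact tendsto_one_sub_mul_tsum (frequency_mem_Icc R) hq hpq hμ

theorem HasCesaroDensity.le_zero_of_tendsto [Finite X] {R : Set (FreeGroup X)} {μ : ℝ}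
    (h : HasCesaroDensity R μ) (h0 : Tendsto (frequency R) atTop (𝓝 0)) : μ ≤ 0 := by
  refine le_of_forall_pos_le_add fun ε hε => ?_
  obtain ⟨K, hK⟩ := eventually_atTop.1 (h0.eventually_le_const hε)
  rw [zero_add]
  exact le_of_tendsto_abel_of_eventually_le (frequency_mem_Icc R) h.tendsto_abel hε.le hK

/-- If the density is positive, then some recurrent state can be reached and is accepting. -/
theorem HasCesaroDensity.exists_isRecurrent [Finite X] {V : Type*} [Finite V]
    (L : LetterAutomaton X V) {init : X × Bool → V} {A : Set V}
    (hinit : ∀ a, L.label (init a) = a) {R : Set (FreeGroup X)}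
    (hR : ∀ a w, a :: w ∈ toWord '' R ↔ FreeGroup.IsReduced (a :: w) ∧ L.eval (init a) w ∈ A)
    {μ : ℝ} (h : HasCesaroDensity R μ) (hμ : 0 < μ) :
    ∃ a s, L.Reach (init a) s ∧ L.IsRecurrent s ∧ s ∈ A := by
  have := Fintype.ofFinite X
  by_contra! hcon
  refine hμ.not_ge (h.le_zero_of_tendsto ((tendsto_add_atTop_iff_nat 1).1 ?_))
  have hlim : Tendsto (fun k => (∑ a, (L.average ^ k) ({u | ¬L.IsRecurrent u}.indicator 1)
      (init a)) / (Fintype.card (X × Bool) : ℝ)) atTop (𝓝 0) := by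
    have := (tendsto_finsetSum Finset.univ fun a _ =>
      L.tendsto_average_pow_indicator (init a)).div_const (Fintype.card (X × Bool) : ℝ)
    simpa using this
  refine squeeze_zero (fun k => (frequency_mem_Icc R _).1) (fun k => ?_) hlim
  rw [frequency_succ L hinit hR]
  gcongr with a _
  refine L.average_pow_le_average_pow k (init a) fun u hu => ?_
  -- By assumption every reachable accepting state is non-recurrent, so the absorption estimate
  -- bounds the frequency.
  by_cases huA : u ∈ A
  · have hrec : u ∈ {u | ¬L.IsRecurrent u} := fun hrec => hcon a u hu hrec huA
    rw [Set.indicator_of_mem huA, Set.indicator_of_mem hrec]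
  · rw [Set.indicator_of_notMem huA]
    exact Set.indicator_nonneg (fun _ _ => zero_le_one) u

end Regular

/-! ### Paths in an automaton and in its automaton of second type -/

namespace Automaton

variable {A S : Type*} (M : Automaton A S)

theorem run_append (s : S) (w v : List A) :
    M.run s (w ++ v) = (M.run s w).bind fun t => M.run t v := by
  induction w generalizing s with
  | nil => rfl
  | cons a w ih => simp [run, ih, Option.bind_assoc]

theorem Reaches.trans {M : Automaton A S} {s t u : S} (h : M.Reaches s t) (h' : M.Reaches t u) :
    M.Reaches s u := by
  obtain ⟨w, hw⟩ := h
  obtain ⟨v, hv⟩ := h'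
  exact ⟨w ++ v, by rw [run_append, hw]; exact hv⟩

theorem second_step_eq_some_iff (s t : {s : S // M.Reaches M.final s}) (a : A) :
    M.second.step s a = some t ↔ M.step s.1 a = some t.1 := by
  simp only [second, Option.pmap_eq_some_iff]
  constructor
  · rintro ⟨u, hu, h, rfl⟩
    exact h
  · intro h
    exact ⟨t.1, t.2, h, rfl⟩

theorem second_run_eq_some_iff (s t : {s : S // M.Reaches M.final s}) (w : List A) :
    M.second.run s w = some t ↔ M.run s.1 w = some t.1 := by
  induction w generalizing s with
  | nil => simp [run, Subtype.ext_iff]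
  | cons a w ih =>
    simp only [run, Option.bind_eq_some_iff]
    constructor
    · rintro ⟨u, hu, h⟩
      exact ⟨u.1, (M.second_step_eq_some_iff s u a).1 hu, (ih u).1 h⟩
    · rintro ⟨u, hu, h⟩
      refine ⟨⟨u, s.2.step hu⟩, (M.second_step_eq_some_iff s _ a).2 hu, (ih _).2 h⟩

theorem mem_accepts_second_iff (w : List A) :
    w ∈ M.second.accepts ↔ M.run M.final w = some M.final :=
  M.second_run_eq_some_iff M.second.start M.second.final w

end Automaton

/-! ### The automaton of closed paths at a state -/

namespace LetterAutomaton

variable {X V : Type*} [DecidableEq X] (L : LetterAutomaton X V) (s : V)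

/-- The automaton that consists of the states reachable from `s` and of a new initial state with a
single arrow, which leads to the final state `s`. -/
def returnAutomaton : Automaton (X × Bool) (Option {t // L.Reach s t}) where
  step
    -- The extra state is initial because `s` itself may have in-edges; its arrow carries the label
    -- of `s`, so that `s` keeps a single type.
    | none, b => if b = L.label s then some (some ⟨s, .refl⟩) else none
    | some t, b =>
      if h : b ≠ invLetter (L.label t.1) then some (some ⟨L.next t b, t.2.tail ⟨b, h, rfl⟩⟩)
      else none
  start := none
  final := some ⟨s, .refl⟩

theorem returnAutomaton_step_some_iff {t : {t // L.Reach s t}} {b : X × Bool}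
    {u : Option {t // L.Reach s t}} :
    (L.returnAutomaton s).step (some t) b = some u ↔
      b ≠ invLetter (L.label t.1) ∧ ∃ h : L.Reach s (L.next t b), u = some ⟨L.next t b, h⟩ := by
  simp only [returnAutomaton]
  split_ifs with h
  · rw [Option.some_inj]
    exact ⟨fun e => ⟨h, t.2.tail ⟨b, h, rfl⟩, e.symm⟩, fun ⟨_, _, e⟩ => e.symm⟩
  · exact ⟨fun e => by simp at e, fun e => absurd e.1 h⟩

theorem label_eq_of_returnAutomaton_step {r : Option {t // L.Reach s t}} {b : X × Bool}
    {t : {t // L.Reach s t}} (h : (L.returnAutomaton s).step r b = some (some t)) :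
    b = L.label t.1 := by
  cases r with
  | none =>
    simp only [returnAutomaton] at h
    split_ifs at h with hb
    simp only [Option.some_inj] at h
    exact h ▸ hb
  | some r =>
    obtain ⟨-, _, e⟩ := (L.returnAutomaton_step_some_iff s).1 h
    rw [Option.some_inj] at e
    rw [e, L.label_next]

theorem returnAutomaton_run_some_iff (t u : {t // L.Reach s t}) (w : List (X × Bool)) :
    (L.returnAutomaton s).run (some t) w = some (some u) ↔
      FreeGroup.IsReduced (L.label t.1 :: w) ∧ L.eval t.1 w = u.1 := by
  induction w generalizing t with
  | nil => simp [run, eval, Subtype.ext_iff]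
  | cons b w ih =>
    simp only [run, Option.bind_eq_some_iff, isReduced_cons_cons_iff]
    constructor
    · rintro ⟨r, hr, h⟩
      obtain ⟨hb, hreach, rfl⟩ := (L.returnAutomaton_step_some_iff s).1 hr
      obtain ⟨h1, h2⟩ := (ih _).1 h
      rw [L.label_next] at h1
      exact ⟨⟨hb, h1⟩, h2⟩
    · rintro ⟨⟨hb, h1⟩, h2⟩
      have hreach : L.Reach s (L.next t.1 b) := t.2.tail ⟨b, hb, rfl⟩
      refine ⟨_, (L.returnAutomaton_step_some_iff s).2 ⟨hb, hreach, rfl⟩, (ih _).2 ⟨?_, h2⟩⟩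
      rwa [L.label_next]

theorem Reach.returnAutomaton_reaches {t u : V} (htu : L.Reach t u) (ht : L.Reach s t) :
    (L.returnAutomaton s).Reaches (some ⟨t, ht⟩) (some ⟨u, Relation.ReflTransGen.trans ht htu⟩) := by
  obtain ⟨w, hw, hred⟩ := htu.exists_word
  refine ⟨w, (L.returnAutomaton_run_some_iff s _ _ w).2 ⟨?_, hw⟩⟩
  simpa using hred [] FreeGroup.IsReduced.singleton

theorem returnAutomaton_start_reaches_final :
    (L.returnAutomaton s).Reaches none (some ⟨s, .refl⟩) :=
  ⟨[L.label s], by simp [run, returnAutomaton]⟩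

/-- Recurrence serves for coaccessibility alone: `s` can be reached again from every state it leads
to. -/
theorem IsRecurrent.returnAutomaton_isSpecial {s : V} (hs : L.IsRecurrent s) :
    (L.returnAutomaton s).IsSpecial where
  start_no_inedge r a := by
    cases r with
    | none =>
      simp only [returnAutomaton]
      split_ifs <;> simp
    | some r =>
      intro h
      obtain ⟨-, _, e⟩ := (L.returnAutomaton_step_some_iff s).1 h
      exact Option.some_ne_none _ e.symm
  accessible t := by
    cases t with
    | none => exact ⟨[], rfl⟩
    | some t =>
      exact Reaches.trans (L.returnAutomaton_start_reaches_final s)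
        (Reach.returnAutomaton_reaches L s t.2 .refl)
  coaccessible t := by
    cases t with
    | none => exact L.returnAutomaton_start_reaches_final s
    | some t => exact Reach.returnAutomaton_reaches L s (hs t t.2) t.2
  type_unique t a b := by
    rintro ⟨r, hr⟩ ⟨r', hr'⟩
    cases t with
    | none =>
      cases r with
      | none =>
        simp only [returnAutomaton] at hr
        split_ifs at hr
        simp at hr
      | some r =>
        obtain ⟨-, _, e⟩ := (L.returnAutomaton_step_some_iff s).1 hr
        exact absurd e.symm (Option.some_ne_none _)
    | some t =>
      rw [L.label_eq_of_returnAutomaton_step s hr, L.label_eq_of_returnAutomaton_step s hr']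
  no_inverse t a := by
    rintro ⟨r, hr⟩
    cases t with
    | none =>
      cases r with
      | none =>
        simp only [returnAutomaton] at hr
        split_ifs at hr
        simp at hr
      | some r =>
        obtain ⟨-, _, e⟩ := (L.returnAutomaton_step_some_iff s).1 hr
        exact absurd e.symm (Option.some_ne_none _)
    | some t =>
      rw [L.label_eq_of_returnAutomaton_step s hr]
      simp [returnAutomaton]

theorem invLetter_ne_self {X : Type*} (a : X × Bool) : a ≠ invLetter a := by
  obtain ⟨x, i⟩ := a
  cases i <;> simp [invLetter]

/-- The type of a state is its label, and only the arrow with the inverse label was removed. The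
added initial state has no type, since no arrow enters it. -/
theorem returnAutomaton_second_isComplete : (L.returnAutomaton s).second.IsComplete := by
  rintro ⟨t, ht⟩ x ⟨⟨r, hr⟩, hrt⟩ y hy
  rw [second_step_eq_some_iff] at hrt
  cases t with
  | none =>
    exfalso
    cases r with
    | none =>
      simp only [returnAutomaton] at hrt
      split_ifs at hrt
      simp at hrt
    | some r =>
      obtain ⟨-, _, e⟩ := (L.returnAutomaton_step_some_iff s).1 hrt
      exact Option.some_ne_none _ e.symm
  | some t =>
    rw [L.label_eq_of_returnAutomaton_step s hrt] at hy
    have hstep := (L.returnAutomaton_step_some_iff s).2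
      ⟨hy, t.2.tail ⟨y, hy, rfl⟩, rfl⟩
    exact ⟨⟨_, ht.step hstep⟩, (second_step_eq_some_iff _ _ _ _).2 hstep⟩

/-- The reduced labels of the closed paths at a recurrent state form a thick monoid. -/
theorem IsRecurrent.isThickMonoid {V : Type} [Finite V] (L : LetterAutomaton X V) {s : V}
    (hs : L.IsRecurrent s) : IsThickMonoid
      {g : FreeGroup X | FreeGroup.IsReduced (L.label s :: g.toWord) ∧ L.eval s g.toWord = s} := by
  refine ⟨_, inferInstance, L.returnAutomaton s, hs.returnAutomaton_isSpecial,
    -- Repeating the last letter never cancels, which provides an arrow out of `s`.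
    ⟨L.label s, _, (L.returnAutomaton_step_some_iff s).2
      ⟨invLetter_ne_self _, .single ⟨_, invLetter_ne_self _, rfl⟩, rfl⟩⟩,
    L.returnAutomaton_second_isComplete s, ?_⟩
  ext g
  rw [Set.mem_ofPred_eq, Set.mem_ofPred_eq, mem_accepts_second_iff]
  exact (L.returnAutomaton_run_some_iff s ⟨s, .refl⟩ ⟨s, .refl⟩ _).symm

end LetterAutomaton

/-- The prefix is a word leading to an accepting recurrent state; appending a closed path at that
state neither cancels nor leaves `R`. -/
theorem IsThick.exists_isReducedProduct {X : Type*} [Finite X] [DecidableEq X]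
    {R : Set (FreeGroup X)} (hR : IsRegularSubset R) (h : IsThick R) :
    ∃ (w : FreeGroup X) (T P : Set (FreeGroup X)),
      IsThickMonoid T ∧ IsReducedProduct w T P ∧ P ⊆ R := by
  obtain ⟨μ, hμ, hpos⟩ := h
  obtain ⟨V, _, L, init, A, hinit, hA⟩ := hR.exists_letterAutomaton
  obtain ⟨a, s, has, hs, hsA⟩ := hμ.exists_isRecurrent L hinit hA hpos
  obtain ⟨w, hw, hred⟩ := has.exists_word
  rw [hinit] at hred
  have hw0 : FreeGroup.IsReduced (a :: w) := by
    simpa using hred [] FreeGroup.IsReduced.singleton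
  have htw : (mk (a :: w)).toWord = a :: w := by rw [toWord_mk, hw0.reduce_eq]
  have hmul : ∀ t : FreeGroup X, FreeGroup.IsReduced (L.label s :: t.toWord) →
      (mk (a :: w) * t).toWord = a :: (w ++ t.toWord) := fun t ht => by
    rw [toWord_mul, htw, List.cons_append, (hred _ ht).reduce_eq]
  refine ⟨mk (a :: w), _, _, hs.isThickMonoid, ⟨fun t ht => ?_, rfl⟩, ?_⟩
  · simp only [FreeGroup.norm, hmul t ht.1, htw, List.length_cons, List.length_append]
    omega
  · rintro _ ⟨t, ht, rfl⟩
    have : a :: (w ++ t.toWord) ∈ toWord '' R := by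
      rw [hA]
      refine ⟨hred _ ht.1, ?_⟩
      have : L.eval (init a) (w ++ t.toWord) = L.eval (L.eval (init a) w) t.toWord :=
        List.foldl_append
      rwa [this, hw, ht.2]
    rw [← hmul t ht.1] at this
    obtain ⟨g, hg, hgt⟩ := this
    rwa [toWord_injective hgt] at hg

/-! ### Counting returns in a complete automaton of second type -/

namespace Automaton

theorem exists_step_of_run {A S : Type*} {M : Automaton A S} {s t : S} {w : List A} (hw : w ≠ [])
    (h : M.run s w = some t) : ∃ r b, M.Reaches s r ∧ M.step r b = some t := by
  induction w generalizing s with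
  | nil => exact absurd rfl hw
  | cons b w ih =>
    simp only [run, Option.bind_eq_some_iff] at h
    obtain ⟨r, hr, h⟩ := h
    rcases eq_or_ne w [] with rfl | hw'
    · simp only [run, Option.some_inj] at h
      exact ⟨s, b, ⟨[], rfl⟩, h ▸ hr⟩
    · obtain ⟨u, c, ⟨v, hv⟩, hu⟩ := ih hw' h
      exact ⟨u, c, ⟨b :: v, by simp [run, hr, hv]⟩, hu⟩

variable {X S : Type*} {M : Automaton (X × Bool) S}

theorem IsSpecial.isReduced_cons (hM : M.IsSpecial) {s t : S} {x : X × Bool}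
    (hx : M.HasType s x) {w : List (X × Bool)} (h : M.run s w = some t) :
    FreeGroup.IsReduced (x :: w) := by
  induction w generalizing s x with
  | nil => exact FreeGroup.IsReduced.singleton
  | cons b w ih =>
    simp only [run, Option.bind_eq_some_iff] at h
    obtain ⟨r, hr, h⟩ := h
    refine isReduced_cons_cons_iff.2 ⟨?_, ih ⟨s, hr⟩ h⟩
    rintro rfl
    rw [hM.no_inverse s x hx] at hr
    exact Option.some_ne_none _ hr.symm

/-- Completeness says nothing about a state without in-edges. An exit from `z₀`, a way back to `z₀`
and a path to `s` together form a nonempty path ending at `s`. -/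
theorem IsSpecial.exists_hasType_second (hM : M.IsSpecial)
    (hexit : ∃ a t, M.step M.final a = some t) (s : {s : S // M.Reaches M.final s}) :
    ∃ x, M.second.HasType s x := by
  obtain ⟨a, t, hat⟩ := hexit
  obtain ⟨v, hv⟩ := hM.coaccessible t
  obtain ⟨u, hu⟩ := s.2
  have hrun : M.run M.final (a :: v ++ u) = some s.1 := by
    rw [run_append]
    simp [run, hat, hv, hu]
  obtain ⟨r, b, hr, hrb⟩ := exists_step_of_run (by simp) hrun
  exact ⟨b, ⟨r, hr⟩, (M.second_step_eq_some_iff _ _ _).2 hrb⟩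

/-- In a complete automaton of second type, the number of words of length about `n` that lead to
the final state is at least the number of all continuations of length `n`. -/
theorem IsSpecial.exists_le_sum_wordCount [Fintype X] [Finite S] (hM : M.IsSpecial)
    (hexit : ∃ a t, M.step M.final a = some t) (hcomp : M.second.IsComplete) :
    ∃ N, ∀ n s, branching X ^ n ≤
      ∑ j ∈ Finset.range N, wordCount (n + j) fun w => M.second.run s w = some M.second.final := by
  classical
  have hreach : ∀ s, ∃ w, M.second.run s w = some M.second.final := fun s => by
    obtain ⟨w, hw⟩ := hM.coaccessible s.1
    exact ⟨w, (M.second_run_eq_some_iff _ _ w).2 hw⟩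
  choose word hword using hreach
  -- `N` bounds the lengths of the chosen words leading to the final state, one for each of the
  -- finitely many states; the window covers the lengths `0` to `N`.
  obtain ⟨N, hN⟩ := (Set.finite_range fun s => (word s).length).bddAbove
  refine ⟨N + 1, fun n => ?_⟩
  induction n with
  | zero =>
    intro s
    have hs : (word s).length ∈ Finset.range (N + 1) :=
      Finset.mem_range.2 (Nat.lt_succ_of_le (hN ⟨s, rfl⟩))
    refine le_trans ?_ (Finset.single_le_sum (fun _ _ => Nat.zero_le _) hs)
    rw [pow_zero, Nat.one_le_iff_ne_zero]
    exact Set.ncard_ne_zero_of_mem (a := word s) ⟨(zero_add _).symm, hword s⟩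
      (finite_wordCount _ _)
  | succ n ih =>
    intro s
    obtain ⟨x, hx⟩ := hM.exists_hasType_second hexit s
    calc branching X ^ (n + 1) = ∑ b with b ≠ invLetter x, branching X ^ n := by
          rw [Finset.sum_const, card_ne_invLetter, smul_eq_mul, pow_succ']
      _ ≤ ∑ b with b ≠ invLetter x, ∑ j ∈ Finset.range (N + 1),
            wordCount (n + j) fun w => M.second.run s (b :: w) = some M.second.final := by
          refine Finset.sum_le_sum fun b hb => ?_
          obtain ⟨t, ht⟩ := hcomp s x hx b (Finset.mem_filter.1 hb).2
          simpa [run, ht] using ih t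
      _ ≤ ∑ b, ∑ j ∈ Finset.range (N + 1),
            wordCount (n + j) fun w => M.second.run s (b :: w) = some M.second.final :=
          Finset.sum_le_sum_of_subset (Finset.filter_subset _ _)
      _ = _ := by
          rw [Finset.sum_comm]
          refine Finset.sum_congr rfl fun j _ => ?_
          rw [add_right_comm, wordCount_succ]

end Automaton

/-! ### Positive density from a thick monoid -/

section ThickMonoid

variable {X : Type*} [Fintype X] [DecidableEq X]

/-- Accepted words are reduced because `z₀` has a type, so counting words is counting group
elements. That type also shows that the alphabet is nonempty. -/
theorem IsThickMonoid.exists_le_sum_ncard {T : Set (FreeGroup X)} (hT : IsThickMonoid T) :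
    Nonempty (X × Bool) ∧ ∃ N, ∀ n, branching X ^ n ≤
      ∑ j ∈ Finset.range N, (T ∩ freeSphere X (n + j)).ncard := by
  obtain ⟨S, _, M, hM, hexit, hcomp, rfl⟩ := hT
  obtain ⟨N, hN⟩ := hM.exists_le_sum_wordCount hexit hcomp
  obtain ⟨x, ⟨r, hr⟩⟩ := hM.exists_hasType_second hexit M.second.final
  have hx : M.HasType M.final x := ⟨r.1, (M.second_step_eq_some_iff _ _ _).1 hr⟩
  refine ⟨⟨x⟩, N, fun n => (hN n M.second.final).trans (le_of_eq ?_)⟩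
  refine Finset.sum_congr rfl fun j _ => ?_
  rw [ncard_inter_freeSphere]
  refine wordCount_congr fun w _ => ⟨fun h => ?_, ?_⟩
  · have hred : FreeGroup.IsReduced w :=
      (hM.isReduced_cons hx ((M.mem_accepts_second_iff w).1 h)).tail
    have hw : (FreeGroup.mk w).toWord = w := by rw [toWord_mk, hred.reduce_eq]
    exact ⟨FreeGroup.mk w, by rw [Set.mem_ofPred_eq, hw]; exact h, hw⟩
  · rintro ⟨g, hg, rfl⟩
    exact hg

theorem IsReducedProduct.ncard_le {w : FreeGroup X} {T P R : Set (FreeGroup X)}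
    (h : IsReducedProduct w T P) (hPR : P ⊆ R) (n : ℕ) :
    (T ∩ freeSphere X n).ncard ≤ (R ∩ freeSphere X (w.norm + n)).ncard := by
  refine Set.ncard_le_ncard_of_injOn (fun t => w * t) ?_ (mul_right_injective w).injOn
    ((finite_freeSphere _).subset Set.inter_subset_right)
  rintro t ⟨ht, htn⟩
  refine ⟨hPR (h.2 ▸ ⟨t, ht, rfl⟩), ?_⟩
  change (w * t).norm = w.norm + n
  rw [h.1 t ht, show t.norm = n from htn]

/-- A set that contains a reduced product with a thick monoid has positive density. -/
theorem HasCesaroDensity.pos_of_isReducedProduct {w : FreeGroup X} {T P R : Set (FreeGroup X)}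
    (hT : IsThickMonoid T) (hP : IsReducedProduct w T P) (hPR : P ⊆ R) {μ : ℝ}
    (hμ : HasCesaroDensity R μ) : 0 < μ := by
  obtain ⟨⟨a⟩, N, hN⟩ := hT.exists_le_sum_ncard
  have hd : (1 : ℝ) ≤ branching X := by exact_mod_cast branching_pos a
  have hd0 : (0 : ℝ) < branching X := by linarith
  have hc : (0 : ℝ) < Fintype.card (X × Bool) := by exact_mod_cast Fintype.card_pos_iff.2 ⟨a⟩
  -- A window contains at least `branching X ^ (n + 1)` elements of the product, and its spheres
  -- have size at most `|Σ| * branching X ^ (w.norm + n + 1 + N)`; `ε` is the quotient. Starting at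
  -- `w.norm + 1` keeps all radii positive, where the formula for the sphere holds.
  set ε : ℝ := 1 / (Fintype.card (X × Bool) * branching X ^ (w.norm + N)) with hε
  have hεpos : 0 < ε := by positivity
  have hle := le_mul_of_tendsto_abel_of_le_sum (frequency_mem_Icc R) hμ.tendsto_abel
    (ε := ε) (K := w.norm + 1) (N := N) fun m hm => by
      obtain ⟨n, rfl⟩ := Nat.exists_eq_add_of_le hm
      calc ε = branching X ^ (n + 1) /
            (Fintype.card (X × Bool) * branching X ^ (w.norm + n + 1 + N)) := by
              rw [hε]
              field_simp
              ring
        _ ≤ (∑ j ∈ Finset.range N, ((T ∩ freeSphere X (n + 1 + j)).ncard : ℝ)) /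
            (Fintype.card (X × Bool) * branching X ^ (w.norm + n + 1 + N)) := by
              gcongr
              exact_mod_cast hN (n + 1)
        _ = ∑ j ∈ Finset.range N, ((T ∩ freeSphere X (n + 1 + j)).ncard : ℝ) /
            (Fintype.card (X × Bool) * branching X ^ (w.norm + n + 1 + N)) := Finset.sum_div _ _ _
        _ ≤ ∑ j ∈ Finset.range N, frequency R (w.norm + 1 + n + j) := by
              refine Finset.sum_le_sum fun j hj => ?_
              have hj := Finset.mem_range.1 hj
              have hk : w.norm + 1 + n + j = w.norm + n + j + 1 := by omega
              have h1 := hP.ncard_le hPR (n + 1 + j)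
              rw [show w.norm + (n + 1 + j) = w.norm + n + j + 1 by omega] at h1
              rw [hk, frequency, ncard_freeSphere_succ]
              push_cast
              refine div_le_div₀ (Nat.cast_nonneg _) (by exact_mod_cast h1) (by positivity) ?_
              exact mul_le_mul_of_nonneg_left (pow_le_pow_right₀ hd (by omega)) hc.le
  by_contra! h
  nlinarith [mul_nonneg (Nat.cast_nonneg (α := ℝ) N) (neg_nonneg.2 h)]

end ThickMonoid

end Thick

end

theorem theorem3p6 {X : Type*} [Finite X] [DecidableEq X] (R : Set (FreeGroup X))
    (hR : IsRegularSubset R) :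
    (∃ μ : ℝ, HasCesaroDensity R μ) ∧
      (IsThick R ↔
        ∃ (w : FreeGroup X) (T P : Set (FreeGroup X)),
          IsThickMonoid T ∧ IsReducedProduct w T P ∧ P ⊆ R) := by
  have := Fintype.ofFinite X
  obtain ⟨μ, hμ⟩ := hR.exists_hasCesaroDensity
  refine ⟨⟨μ, hμ⟩, fun h => h.exists_isReducedProduct hR, ?_⟩
  rintro ⟨w, T, P, hT, hP, hPR⟩
  exact ⟨μ, hμ, hμ.pos_of_isReducedProduct hT hP hPR⟩
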